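/- Throughout, $\|\cdot\|$ is the supremum norm. For $f:(0,\infty)\to(0,\infty)$ let $\mathrm{UA}_{n,1}(f)$ be the set of (column) vectors $\mathbf{x}\in\mathbb{R}^n$ such that for every sufficiently large $t$ there are $q\in\mathbb{Z}\smallsetminus\{0\}$ and $\mathbf{p}\in\mathbb{Z}^n$ with $|q|\le t$ and $\|q\mathbf{x}-\mathbf{p}\|\le f(t)$. Let $\hat\omega(\mathbf{x})\in[0,\infty]$ be the supremum of all $a>0$ such that $\mathbf{x}\in \mathrm{UA}_{n,1}(t\mapsto t^{-a})$. A rational affine subspace of $\mathbb{R}^n$ is a nonempty set of solutions of a system of affine equations with rational coefficients; $\mathbf{x}$ is totally irrational if it lies in no proper rational affine subspace of $\mathbb{R}^n$. A $k$-dimensional analytic submanifold of $\mathbb{R}^n$ is a subset $Y$ such that every $\mathbf{y}\in Y$ has an open neighbourhood $V$ in $\mathbb{R}^n$ for which $V\cap Y=\Psi(U)$, where $U\subset\mathbb{R}^k$ is open and $\Psi:U\to\mathbb{R}^n$ is real analytic, has injective derivative at every point, and is a homeomorphism onto its image. **Theorem.** Let $n\ge2$ and let $Y$ be a (nonempty)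 connected analytic submanifold of $\mathbb{R}^n$ of dimension $d\ge 2$. 1. Let $f:(0,\infty)\to(0,\infty)$ be a continuous function such that $t^{\frac{1}{n-d+1}}f(t)$ tends to $\infty$ as $t\to\infty$ and is non-decreasing for all sufficiently large $t$. (a) For every countable collection $\{R_\ell\}$ of analytic submanifolds of $\mathbb{R}^n$ (of any dimensions), each of which is a proper, relatively closed subset of $Y$, the set $\big(Y\cap \mathrm{UA}_{n,1}(f)\big)\smallsetminus\bigcup_\ell R_\ell$ is uncountable and dense in $Y$. (b) If $Y$ is not contained in any proper rational affine subspace of $\mathbb{R}^n$, then the set of totally irrational $\mathbf{x}\in Y\cap\mathrm{UA}_{n,1}(f)$ is uncountable and dense in $Y$. 2. If $Y$ is not contained in any proper rational affine subspace of $\mathbb{R}^n$, then the set of totally irrational $\mathbf{x}\in Y$ with $\hat\omega(\mathbf{x})\ge\frac{1}{n-d+1}$ is uncountable and dense in $Y$. -/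

import Mathlib

open Set Filter Topology

/-- A real `m × n` matrix `A` is `f`-uniform if for every sufficiently large `t` there are
`q ∈ ℤⁿ ∖ {0}` and `p ∈ ℤᵐ` with `‖A q - p‖ ≤ f t` and `‖q‖ ≤ t`. All norms are supremum norms.
Only the values of `f` at (large) positive arguments matter. -/
def IsUniformlyApproximable {m n : ℕ} (f : ℝ → ℝ) (A : Matrix (Fin m) (Fin n) ℝ) : Prop :=
  ∀ᶠ t : ℝ in atTop, ∃ q : Fin n → ℤ, ∃ p : Fin m → ℤ,
    q ≠ 0 ∧ ‖A.mulVec (fun j => (q j : ℝ)) - (fun i => (p i : ℝ))‖ ≤ f t ∧ ‖q‖ ≤ t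

/-- The set of `f`-uniform `m × n` matrices. -/
def UA (m n : ℕ) (f : ℝ → ℝ) : Set (Matrix (Fin m) (Fin n) ℝ) :=
  {A | IsUniformlyApproximable f A}

/-- The identification of `ℝⁿ` with the space of `n × 1` matrices (column vectors). -/
def toColumn {n : ℕ} (x : Fin n → ℝ) : Matrix (Fin n) (Fin 1) ℝ :=
  Matrix.of fun i _ => x i

/-- The uniform Diophantine exponent: the supremum, in the extended reals, of the `a > 0` such
that `A` is uniformly approximable with respect to `t ↦ t ^ (-a)`. -/
noncomputable def uniformExponent {m n : ℕ} (A : Matrix (Fin m) (Fin n) ℝ) : EReal :=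
  sSup ((fun a : ℝ => (a : EReal)) '' {a : ℝ | 0 < a ∧ A ∈ UA m n (fun t => t ^ (-a))})

/-- A rational affine subspace of `ℝⁿ`: a nonempty affine subspace which is the set of solutions
of a system of affine equations with rational coefficients. -/
def IsRationalAffineSubspace {n : ℕ} (S : AffineSubspace ℝ (Fin n → ℝ)) : Prop :=
  (S : Set (Fin n → ℝ)).Nonempty ∧
    ∃ E : Set ((Fin n → ℚ) × ℚ),
      (S : Set (Fin n → ℝ)) = {x | ∀ e ∈ E, ∑ i, (e.1 i : ℝ) * x i = (e.2 : ℝ)}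

/-- A vector is totally irrational if it lies in no proper rational affine subspace. -/
def IsTotallyIrrational {n : ℕ} (x : Fin n → ℝ) : Prop :=
  ∀ S : AffineSubspace ℝ (Fin n → ℝ), IsRationalAffineSubspace S → S ≠ ⊤ → x ∉ S

/-- `Y` is a `d`-dimensional real analytic (embedded) submanifold of `ℝⁿ`: near each of its points,
`Y` is the image of an open subset `U` of `ℝᵈ` under a real analytic map which has injective
derivative at each point of `U` and is a homeomorphism from `U` onto its image. -/
def IsAnalyticSubmanifold {n : ℕ} (d : ℕ) (Y : Set (Fin n → ℝ)) : Prop :=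
  ∀ y ∈ Y, ∃ V : Set (Fin n → ℝ), IsOpen V ∧ y ∈ V ∧
    ∃ (U : Set (Fin d → ℝ)) (Ψ : (Fin d → ℝ) → (Fin n → ℝ)),
      IsOpen U ∧ AnalyticOnNhd ℝ Ψ U ∧
      (∀ u ∈ U, Function.Injective (fderiv ℝ Ψ u)) ∧
      IsEmbedding (fun u : U => Ψ u) ∧
      V ∩ Y = Ψ '' U

/-- `R` is a proper closed analytic submanifold of `Y`, of some dimension; closed means relatively
closed in `Y`. -/
def IsProperClosedAnalyticSubmanifold {n : ℕ} (R Y : Set (Fin n → ℝ)) : Prop :=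
  R ⊂ Y ∧ (∃ k : ℕ, IsAnalyticSubmanifold k R) ∧ ∃ C : Set (Fin n → ℝ), IsClosed C ∧ R = Y ∩ C

/-- `S` is a subset of `Y` which is uncountable and dense in `Y`. -/
def IsUncountableDenseIn {n : ℕ} (S Y : Set (Fin n → ℝ)) : Prop :=
  S ⊆ Y ∧ ¬ S.Countable ∧ Y ⊆ closure S

/-! Locally `Y` is a graph over `d` of its coordinates. Points whose chosen coordinates lie on a
rational line `c + ℝ e` fill a rational affine subspace, and approximating them involves only the
line parameter and the `n - d` remaining coordinates. Dirichlet's theorem in dimension `n - d + 1`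
then gives the rate `C t ^ (-1/(n-d+1))`, with `C` and the starting time depending on the line alone
(`exists_hasIntMultipleNear_of_rational_line`). Eventually `f / 2` exceeds this rate.

The required point is a limit of nested balls with rational centres
(`IsApproximationBall.exists_next`). Each new centre lies on a rational line through the old one,
very close to it. The line has one starting time for all its points; until then the new ball
inherits approximability from the old centre by continuity, and afterwards the new centre is
approximable by itself, so no range of `t` is missed. The line can be chosen to leave the next
forbidden set arbitrarily near the old centre: otherwise analyticity and density of rational points
would put a whole ball in that set, contradicting connectedness of `Y`
(`IsProperAnalyticSubset.not_eventually_mem`).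

Uncountability, total irrationality and the exponent bound follow by choosing the forbidden sets and
`f`. -/

/-! ### Submanifolds as local graphs -/

/-- An injective linear map into `ℝⁿ` stays injective after projecting to suitable coordinates. -/
theorem exists_coordinates_of_injective {n d : ℕ} (D : (Fin d → ℝ) →ₗ[ℝ] (Fin n → ℝ))
    (hD : Function.Injective D) :
    ∃ σ : Fin d → Fin n, Function.Injective σ ∧
      Function.Injective ((LinearMap.funLeft ℝ ℝ σ).comp D) := by
  let v : Fin n → Module.Dual ℝ (Fin d → ℝ) := fun i => (LinearMap.proj i).comp D
  obtain ⟨κ, a, ha, hspan, hli⟩ := exists_linearIndependent' ℝ v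
  have : Finite κ := Finite.of_injective a ha
  have := Fintype.ofFinite κ
  have hinj : Function.Injective ((LinearMap.funLeft ℝ ℝ a).comp D) := by
    rw [injective_iff_map_eq_zero]
    intro w hw
    apply (injective_iff_map_eq_zero D).1 hD
    -- A vector killed by the selected row functionals is killed by their span, hence by every row
    -- of `D`.
    have hle : Submodule.span ℝ (range (v ∘ a)) ≤ LinearMap.ker (LinearMap.applyₗ w) := by
      rw [Submodule.span_le]
      rintro _ ⟨k, rfl⟩
      simpa [v] using congrFun hw k
    rw [hspan] at hle
    funext i
    have := hle (Submodule.subset_span ⟨i, rfl⟩)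
    simpa [v] using this
  have h1 : d ≤ Fintype.card κ := by
    simpa using LinearMap.finrank_le_finrank_of_injective hinj
  have h2 : Fintype.card κ ≤ d := by
    have := hli.fintype_card_le_finrank
    rwa [Subspace.dual_finrank_eq, Module.finrank_fin_fun] at this
  let e : Fin d ≃ κ := (Fintype.equivFinOfCardEq (le_antisymm h2 h1)).symm
  refine ⟨a ∘ e, ha.comp e.injective, ?_⟩
  intro x y hxy
  apply hinj
  funext k
  have := congrFun hxy (e.symm k)
  simpa [LinearMap.funLeft] using this

/-- Near each of its points, an analytic submanifold of `ℝⁿ` is the graph of an analytic function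
of suitable `d` coordinates. -/
theorem IsAnalyticSubmanifold.exists_graph {n d : ℕ} {Y : Set (Fin n → ℝ)}
    (hY : IsAnalyticSubmanifold d Y) {y : Fin n → ℝ} (hy : y ∈ Y) :
    ∃ (σ : Fin d → Fin n) (Ψ : (Fin d → ℝ) → (Fin n → ℝ)), Function.Injective σ ∧
      AnalyticAt ℝ Ψ (y ∘ σ) ∧ Ψ (y ∘ σ) = y ∧
      (∀ᶠ u in 𝓝 (y ∘ σ), Ψ u ∈ Y ∧ Ψ u ∘ σ = u) ∧
      ∀ᶠ z in 𝓝 y, z ∈ Y → Ψ (z ∘ σ) = z := by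
  obtain ⟨V, hV, hyV, U, Φ, hU, hΦ, hinj, hemb, hVY⟩ := hY y hy
  obtain ⟨u₀, hu₀, rfl⟩ : y ∈ Φ '' U := hVY ▸ ⟨hyV, hy⟩
  obtain ⟨σ, hσ, hσD⟩ :=
    exists_coordinates_of_injective (fderiv ℝ Φ u₀).toLinearMap (hinj u₀ hu₀)
  let π : (Fin n → ℝ) →L[ℝ] (Fin d → ℝ) := (LinearMap.funLeft ℝ ℝ σ).toContinuousLinearMap
  let L : (Fin d → ℝ) ≃L[ℝ] (Fin d → ℝ) :=
    (LinearEquiv.ofInjectiveEndo _ hσD).toContinuousLinearEquiv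
  have hF : AnalyticAt ℝ (fun u => π (Φ u)) u₀ := (π.analyticAt _).comp (hΦ u₀ hu₀)
  have hFd : HasStrictFDerivAt (fun u => π (Φ u)) (L : (Fin d → ℝ) →L[ℝ] (Fin d → ℝ)) u₀ := by
    have hL : (L : (Fin d → ℝ) →L[ℝ] (Fin d → ℝ)) = π.comp (fderiv ℝ Φ u₀) := by
      ext
      rfl
    rw [hL]
    exact π.hasStrictFDerivAt.comp u₀ (hΦ u₀ hu₀).hasStrictFDerivAt
  -- Inverse function theorem: the chosen coordinates serve as parameters, and `Φ ∘ G.symm` is the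
  -- graph map.
  let G := hFd.toOpenPartialHomeomorph
  have hG : ∀ u, G u = Φ u ∘ σ := fun u => rfl
  have hsrc : u₀ ∈ G.source := hFd.mem_toOpenPartialHomeomorph_source
  have hsymm : AnalyticAt ℝ G.symm (Φ u₀ ∘ σ) :=
    G.analyticAt_symm' hsrc hF hFd.hasFDerivAt.fderiv
  have hG0 : G.symm (Φ u₀ ∘ σ) = u₀ := G.left_inv hsrc
  refine ⟨σ, Φ ∘ G.symm, hσ, ?_, ?_, ?_, ?_⟩
  · apply AnalyticAt.comp _ hsymm
    rw [hG0]
    exact hΦ u₀ hu₀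
  · rw [Function.comp_apply, hG0]
  · have h1 : ∀ᶠ u in 𝓝 (Φ u₀ ∘ σ), G.symm u ∈ U :=
      hsymm.continuousAt.eventually (by rw [hG0]; exact hU.mem_nhds hu₀)
    filter_upwards [h1, G.open_target.mem_nhds (G.map_source hsrc)] with u hu hut
    refine ⟨?_, G.right_inv hut⟩
    have : Φ (G.symm u) ∈ V ∩ Y := hVY ▸ mem_image_of_mem _ hu
    exact this.2
  -- The embedding property is essential: points of `Y` near `Φ u₀` must have parameters near `u₀`,
  -- where `G` is invertible.
  · have h1 : ∀ᶠ u : U in 𝓝 ⟨u₀, hu₀⟩, (u : Fin d → ℝ) ∈ G.source :=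
      continuous_subtype_val.continuousAt.eventually (G.open_source.mem_nhds hsrc)
    rw [hemb.isInducing.nhds_eq_comap, eventually_comap] at h1
    filter_upwards [h1, hV.mem_nhds hyV] with z hz hzV hzY
    obtain ⟨u, hu, rfl⟩ : z ∈ Φ '' U := hVY ▸ ⟨hzV, hzY⟩
    have : G.symm (Φ u ∘ σ) = u := G.left_inv (hz ⟨u, hu⟩ rfl)
    simp only [Function.comp_apply, this]

/-! ### Proper analytic subsets -/

/-- A relatively closed, locally analytic subset of a connected set which has an interior
point is everything. -/
theorem subset_of_eventually_mem_of_locally_analytic {E : Type*} [NormedAddCommGroup E]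
    [NormedSpace ℝ E] {J Z : Set E} (hJc : IsPreconnected J)
    (hcl : ∀ s ∈ J, s ∈ closure Z → s ∈ Z)
    (hZ : ∀ s ∈ J, s ∈ Z → ∃ g : E → ℝ, AnalyticAt ℝ g s ∧ ∀ᶠ x in 𝓝 s, (x ∈ Z ↔ g x = 0))
    {s₀ : E} (hs₀ : s₀ ∈ J) (hs₀Z : ∀ᶠ x in 𝓝 s₀, x ∈ Z) : J ⊆ Z := by
  have hsub : J ⊆ {s | ∀ᶠ x in 𝓝 s, x ∈ Z} := by
    refine hJc.subset_of_closure_inter_subset isOpen_setOfPred_eventually_nhds ⟨s₀, hs₀, hs₀Z⟩ ?_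
    rintro s ⟨hscl, hsJ⟩
    have hsZ : s ∈ Z := hcl s hsJ
      (closure_mono (fun x (hx : ∀ᶠ x' in 𝓝 x, x' ∈ Z) => hx.self_of_nhds) hscl)
    obtain ⟨g, hg, hgZ⟩ := hZ s hsJ hsZ
    obtain ⟨r, hr, hball⟩ := Metric.eventually_nhds_iff_ball.1
      (hg.eventually_analyticAt.and hgZ)
    obtain ⟨x, hx, hxZ⟩ := mem_closure_iff_nhds.1 hscl _ (Metric.ball_mem_nhds s hr)
    have hzero : EqOn g 0 (Metric.ball s r) := by
      refine AnalyticOnNhd.eqOn_zero_of_preconnected_of_eventuallyEq_zero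
        (fun x hx => (hball x hx).1) (convex_ball s r).isPreconnected hx ?_
      filter_upwards [hxZ, Metric.isOpen_ball.mem_nhds hx] with x' hx' hx'b
      exact (hball x' hx'b).2.1 hx'
    filter_upwards [Metric.ball_mem_nhds s hr] with x hx
    exact (hball x hx).2.2 (hzero hx)
  exact fun s hs => (hsub hs).self_of_nhds

/-- `R` is a relatively closed subset of `Y`, different from `Y`, and locally the zero set in `Y` of
a real analytic function. -/
structure IsProperAnalyticSubset {n : ℕ} (R Y : Set (Fin n → ℝ)) : Prop where
  exists_notMem : ∃ y ∈ Y, y ∉ R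
  mem_of_mem_closure : ∀ y ∈ Y, y ∈ closure R → y ∈ R
  exists_analyticAt : ∀ y ∈ Y, y ∈ R → ∃ g : (Fin n → ℝ) → ℝ, AnalyticAt ℝ g y ∧
    ∀ᶠ z in 𝓝 y, z ∈ Y → (z ∈ R ↔ g z = 0)

/-- Over `ℝ`, a sum of squares merges a system of analytic equations into one. -/
theorem AnalyticAt.sum_sq_sub {E ι : Type*} [NormedAddCommGroup E] [NormedSpace ℝ E] [Fintype ι]
    {f g : E → ι → ℝ} {x : E} (hf : AnalyticAt ℝ f x) (hg : AnalyticAt ℝ g x) :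
    AnalyticAt ℝ (fun z => ∑ i, (f z i - g z i) ^ 2) x := by
  refine Finset.analyticAt_fun_sum _ fun i _ => AnalyticAt.pow ?_ 2
  exact (((ContinuousLinearMap.proj (R := ℝ) (φ := fun _ : ι => ℝ) i).analyticAt _).comp hf).sub
    (((ContinuousLinearMap.proj (R := ℝ) (φ := fun _ : ι => ℝ) i).analyticAt _).comp hg)

theorem sum_sq_sub_eq_zero_iff {ι : Type*} [Fintype ι] {x y : ι → ℝ} :
    ∑ i, (x i - y i) ^ 2 = 0 ↔ x = y := by
  rw [Finset.sum_eq_zero_iff_of_nonneg fun i _ => sq_nonneg _]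
  simp [funext_iff, sub_eq_zero]

/-- Writing `R` locally as a graph, its defining equation is `Ψ (z ∘ σ) = z`. -/
theorem IsProperClosedAnalyticSubmanifold.isProperAnalyticSubset {n : ℕ}
    {R Y : Set (Fin n → ℝ)} (h : IsProperClosedAnalyticSubmanifold R Y) :
    IsProperAnalyticSubset R Y := by
  obtain ⟨hRY, ⟨k, hk⟩, C, hC, hRC⟩ := h
  refine ⟨not_subset.1 hRY.2, fun y hy hyc => ?_, fun y _ hyR => ?_⟩
  · rw [hRC]
    exact ⟨hy, closure_minimal (by rw [hRC]; exact inter_subset_right) hC hyc⟩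
  · obtain ⟨σ, Ψ, -, hΨ, -, hmem, hgraph⟩ := hk.exists_graph hyR
    let π : (Fin n → ℝ) →L[ℝ] (Fin k → ℝ) := (LinearMap.funLeft ℝ ℝ σ).toContinuousLinearMap
    refine ⟨fun z => ∑ i, (Ψ (z ∘ σ) i - z i) ^ 2,
      AnalyticAt.sum_sq_sub (AnalyticAt.comp (f := π) hΨ (π.analyticAt y)) analyticAt_id, ?_⟩
    filter_upwards [π.continuous.continuousAt.eventually hmem, hgraph] with z hz hzg _
    rw [sum_sq_sub_eq_zero_iff]
    exact ⟨hzg, fun h => h ▸ hz.1⟩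

theorem isProperAnalyticSubset_singleton {n : ℕ} {Y : Set (Fin n → ℝ)} (hY : Y.Nontrivial)
    (x : Fin n → ℝ) : IsProperAnalyticSubset {x} Y := by
  refine ⟨?_, fun y _ h => by simpa using h, fun y _ _ => ?_⟩
  · obtain ⟨y, hy, hyx⟩ := hY.exists_ne x
    exact ⟨y, hy, hyx⟩
  · refine ⟨fun z => ∑ i, (z i - x i) ^ 2,
      AnalyticAt.sum_sq_sub analyticAt_id analyticAt_const, Eventually.of_forall fun z _ => ?_⟩
    rw [sum_sq_sub_eq_zero_iff]
    rfl

/-- The hyperplane with rational equation `e`. -/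
def rationalHyperplane {n : ℕ} (e : (Fin n → ℚ) × ℚ) : Set (Fin n → ℝ) :=
  {x | ∑ i, (e.1 i : ℝ) * x i = (e.2 : ℝ)}

theorem isProperAnalyticSubset_rationalHyperplane {n : ℕ} {Y : Set (Fin n → ℝ)}
    (e : (Fin n → ℚ) × ℚ) (hY : ¬ Y ⊆ rationalHyperplane e) :
    IsProperAnalyticSubset (rationalHyperplane e) Y := by
  have hcl : IsClosed (rationalHyperplane e) :=
    isClosed_eq (by fun_prop) continuous_const
  refine ⟨not_subset.1 hY, fun y _ h => hcl.closure_eq ▸ h, fun y _ _ => ?_⟩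
  refine ⟨fun x => ∑ i, (e.1 i : ℝ) * x i - e.2, ?_, Eventually.of_forall ?_⟩
  · refine AnalyticAt.sub (Finset.analyticAt_fun_sum _ fun i _ => ?_) analyticAt_const
    exact analyticAt_const.mul
      ((ContinuousLinearMap.proj (R := ℝ) (φ := fun _ : Fin n => ℝ) i).analyticAt _)
  · intro z _
    simp [rationalHyperplane, sub_eq_zero]

/-- A proper analytic subset of a connected analytic submanifold has no interior points. -/
theorem IsProperAnalyticSubset.not_eventually_mem {n d : ℕ} {R Y : Set (Fin n → ℝ)}
    (hR : IsProperAnalyticSubset R Y) (hY : IsAnalyticSubmanifold d Y) (hYc : IsPreconnected Y)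
    {y : Fin n → ℝ} (hy : y ∈ Y) : ¬ ∀ᶠ z in 𝓝 y, z ∈ Y → z ∈ R := by
  intro hyR
  have : PreconnectedSpace Y := isPreconnected_iff_preconnectedSpace.1 hYc
  -- The relative interior of `R` in `Y` is closed too: near a limit point, the identity principle
  -- on a parameter ball spreads membership in `R` over a whole neighbourhood.
  let A : Set Y := {w | ∀ᶠ z : Y in 𝓝 w, (z : Fin n → ℝ) ∈ R}
  have hA : IsClopen A := by
    refine ⟨isClosed_of_closure_subset fun w hw => ?_, isOpen_setOfPred_eventually_nhds⟩
    obtain ⟨σ, Ψ, -, hΨ, hΨw, hmem, hgraph⟩ := hY.exists_graph w.2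
    obtain ⟨r, hr, hball⟩ := Metric.eventually_nhds_iff_ball.1
      (hΨ.eventually_analyticAt.and hmem)
    have hπ : Continuous fun z : Y => (z : Fin n → ℝ) ∘ σ :=
      continuous_pi fun i => (continuous_apply (σ i)).comp continuous_subtype_val
    have hnear : ∀ᶠ z : Y in 𝓝 w, (z : Fin n → ℝ) ∘ σ ∈ Metric.ball (w.1 ∘ σ) r ∧
        Ψ (z.1 ∘ σ) = z := by
      filter_upwards [hπ.continuousAt.eventually (Metric.ball_mem_nhds (w.1 ∘ σ) hr),
        continuous_subtype_val.continuousAt.eventually hgraph] with z hz hz'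
      exact ⟨hz, hz' z.2⟩
    obtain ⟨z, ⟨hzb, hzΨ⟩, hzA⟩ := mem_closure_iff_nhds.1 hw _ hnear
    have hsub : Metric.ball (w.1 ∘ σ) r ⊆ {u | u ∈ Metric.ball (w.1 ∘ σ) r ∧ Ψ u ∈ R} := by
      refine subset_of_eventually_mem_of_locally_analytic
        (convex_ball _ r).isPreconnected ?_ ?_ hzb ?_
      · intro s hs hscl
        refine ⟨hs, hR.mem_of_mem_closure _ (hball s hs).2.1 ?_⟩
        exact closure_mono (by rintro _ ⟨u, hu, rfl⟩; exact hu.2)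
          (mem_closure_image (hball s hs).1.continuousAt hscl)
      · intro s hs hsR
        obtain ⟨g, hg, hgR⟩ := hR.exists_analyticAt _ (hball s hs).2.1 hsR.2
        refine ⟨g ∘ Ψ, hg.comp (hball s hs).1, ?_⟩
        filter_upwards [(hball s hs).1.continuousAt.eventually hgR,
          Metric.isOpen_ball.mem_nhds hs] with x hx hxb
        rw [Function.comp_apply, ← hx (hball x hxb).2.1]
        exact ⟨fun h => h.2, fun h => ⟨hxb, h⟩⟩
      · have hzR : ∀ᶠ x in 𝓝 (z : Fin n → ℝ), x ∈ Y → x ∈ R := by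
          have : ∀ᶠ z' : Y in 𝓝 z, (z' : Fin n → ℝ) ∈ R := hzA
          rw [nhds_subtype_eq_comap, eventually_comap] at this
          filter_upwards [this] with x hx hxY
          exact hx ⟨x, hxY⟩ rfl
        have hc := (hball _ hzb).1.continuousAt
        rw [← hzΨ] at hzR
        filter_upwards [hc.eventually hzR, Metric.isOpen_ball.mem_nhds hzb] with x hx hxb
        exact ⟨hxb, hx (hball x hxb).2.1⟩
    filter_upwards [hnear] with x hx
    exact hx.2 ▸ (hsub hx.1).2
  have huniv : A = univ := hA.eq_univ ⟨⟨y, hy⟩,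
    continuous_subtype_val.continuousAt.eventually hyR |>.mono fun z hz => hz z.2⟩
  obtain ⟨x, hx, hxR⟩ := hR.exists_notMem
  have hxA : ∀ᶠ z : Y in 𝓝 ⟨x, hx⟩, (z : Fin n → ℝ) ∈ R :=
    (huniv ▸ mem_univ _ : (⟨x, hx⟩ : Y) ∈ A)
  exact hxR hxA.self_of_nhds

/-! ### Uniform approximation on rational lines -/

/-- Dirichlet's theorem on simultaneous approximation. -/
theorem exists_int_abs_mul_sub_le {ι : Type*} [Fintype ι] (θ : ι → ℝ) {M : ℕ} (hM : 0 < M) :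
    ∃ q : ℕ, 0 < q ∧ q ≤ M ^ Fintype.card ι ∧ ∃ p : ι → ℤ, ∀ i, |q * θ i - p i| ≤ 1 / M := by
  classical
  have hM' : (0 : ℝ) < M := Nat.cast_pos.2 hM
  have hlt : ∀ x : ℝ, ⌊Int.fract x * M⌋₊ < M := fun x => by
    rw [Nat.floor_lt (mul_nonneg (Int.fract_nonneg _) hM'.le)]
    nlinarith [Int.fract_lt_one x]
  -- Pigeonhole: one more multiple of `θ` than there are cells of side `1 / M` in the unit cube.
  let F : Fin (M ^ Fintype.card ι + 1) → ι → Fin M :=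
    fun q i => ⟨⌊Int.fract ((q : ℕ) * θ i) * M⌋₊, hlt _⟩
  have key : ∃ x y : Fin (M ^ Fintype.card ι + 1), x < y ∧ F x = F y := by
    obtain ⟨x, y, hne, heq⟩ := Fintype.exists_ne_map_eq_of_card_lt F (by simp)
    rcases lt_or_gt_of_ne hne with h | h
    · exact ⟨x, y, h, heq⟩
    · exact ⟨y, x, h, heq.symm⟩
  obtain ⟨x, y, hxy, heq⟩ := key
  have hxy' : (x : ℕ) < y := hxy
  refine ⟨y - x, Nat.sub_pos_of_lt hxy', by omega,
    fun i => ⌊(y : ℕ) * θ i⌋ - ⌊(x : ℕ) * θ i⌋, fun i => ?_⟩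
  have hfl : ⌊Int.fract ((x : ℕ) * θ i) * M⌋₊ = ⌊Int.fract ((y : ℕ) * θ i) * M⌋₊ :=
    congrArg Fin.val (congrFun heq i)
  have hx1 := Nat.floor_le (mul_nonneg (Int.fract_nonneg ((x : ℕ) * θ i)) hM'.le)
  have hx2 := Nat.lt_floor_add_one (Int.fract ((x : ℕ) * θ i) * M)
  have hy1 := Nat.floor_le (mul_nonneg (Int.fract_nonneg ((y : ℕ) * θ i)) hM'.le)
  have hy2 := Nat.lt_floor_add_one (Int.fract ((y : ℕ) * θ i) * M)
  rw [hfl] at hx1 hx2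
  have h1 := Int.self_sub_floor ((x : ℕ) * θ i)
  have h2 := Int.self_sub_floor ((y : ℕ) * θ i)
  have : (((y : ℕ) - (x : ℕ) : ℕ) : ℝ) * θ i - ((⌊(y : ℕ) * θ i⌋ - ⌊(x : ℕ) * θ i⌋ : ℤ) : ℝ) =
      Int.fract ((y : ℕ) * θ i) - Int.fract ((x : ℕ) * θ i) := by
    rw [← h1, ← h2]
    push_cast [Nat.cast_sub hxy'.le]
    ring
  rw [this, abs_le, ← neg_div, div_le_iff₀ hM', le_div_iff₀ hM']
  constructor <;> nlinarith

/-- Some multiple `q ≠ 0` of `x` with `|q| ≤ τ` is within `δ` of an integer vector. -/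
def HasIntMultipleNear {n : ℕ} (δ τ : ℝ) (x : Fin n → ℝ) : Prop :=
  ∃ (q : ℤ) (p : Fin n → ℤ), q ≠ 0 ∧ |(q : ℝ)| ≤ τ ∧ ∀ i, |q * x i - p i| ≤ δ

theorem toColumn_mem_UA {n : ℕ} {f : ℝ → ℝ} (hf : ∀ t, 0 < t → 0 < f t) {x : Fin n → ℝ}
    (h : ∀ᶠ t in atTop, HasIntMultipleNear (f t) t x) : toColumn x ∈ UA n 1 f := by
  change ∀ᶠ t : ℝ in atTop, _
  filter_upwards [h, eventually_gt_atTop 0] with t ht ht0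
  obtain ⟨q, p, hq, hqt, hp⟩ := ht
  refine ⟨fun _ => q, p, fun h => hq (congrFun h 0), ?_, ?_⟩
  · rw [pi_norm_le_iff_of_nonneg (hf t ht0).le]
    intro i
    have := hp i
    rw [mul_comm] at this
    simpa [Matrix.mulVec, dotProduct, toColumn] using this
  · rw [pi_norm_le_iff_of_nonneg ht0.le]
    intro i
    simpa [Int.norm_eq_abs] using hqt

theorem exists_common_denominator {ι : Type*} [Fintype ι] (c : ι → ℚ) :
    ∃ N : ℕ, 0 < N ∧ ∃ a : ι → ℤ, ∀ i, (N : ℝ) * c i = a i := by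
  classical
  refine ⟨∏ i, (c i).den, Finset.prod_pos fun i _ => (c i).den_pos,
    fun i => (c i).num * ∏ j ∈ Finset.univ.erase i, ((c j).den : ℤ), fun i => ?_⟩
  have h : ((c i).den : ℝ) * c i = (c i).num := by
    exact_mod_cast Rat.den_mul_eq_num (c i)
  rw [← Finset.mul_prod_erase Finset.univ _ (Finset.mem_univ i)]
  push_cast
  rw [← h]
  ring

/-- Points of a rational subspace `{x | x ∘ σ ∈ c + ℝ e}`, of dimension `m = n - d + 1`, are
uniformly approximable at the Dirichlet rate of `ℝᵐ`, uniformly in the point. -/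
theorem exists_hasIntMultipleNear_of_rational_line {n d : ℕ} {σ : Fin d → Fin n}
    (hσ : Function.Injective σ) (c e : Fin d → ℚ) :
    ∃ C T : ℝ, ∀ t, T ≤ t → ∀ (x : Fin n → ℝ) (s : ℝ), (∀ i, x (σ i) = c i + s * e i) →
      HasIntMultipleNear (C * t ^ (-(1 / ((n : ℝ) - d + 1)))) (t / 2) x := by
  classical
  obtain ⟨N, hN, ab, hab⟩ := exists_common_denominator (Sum.elim c e)
  let a : Fin d → ℤ := fun i => ab (Sum.inl i)
  let b : Fin d → ℤ := fun i => ab (Sum.inr i)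
  have ha : ∀ i, (N : ℝ) * c i = a i := fun i => hab (Sum.inl i)
  have hb : ∀ i, (N : ℝ) * e i = b i := fun i => hab (Sum.inr i)
  -- `none` stands for the line parameter `s`, `some j` for a coordinate outside `range σ`.
  let ι := Option {j // j ∉ range σ}
  have hdn : d ≤ n := by simpa using Fintype.card_le_of_injective σ hσ
  have hcard : (Fintype.card ι : ℝ) = (n : ℝ) - d + 1 := by
    have h1 : Fintype.card {j // j ∉ range σ} = n - d := by
      rw [Fintype.card_subtype_compl (· ∈ range σ), Fintype.card_fin,
        Fintype.card_congr (Equiv.ofInjective σ hσ).symm, Fintype.card_fin]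
    rw [Fintype.card_option, h1]
    push_cast [Nat.cast_sub hdn]
    ring
  have hm : (0 : ℝ) < Fintype.card ι := by
    rw [hcard]
    have : (d : ℝ) ≤ n := Nat.cast_le.2 hdn
    linarith
  rw [← hcard]
  set m : ℝ := (Fintype.card ι : ℝ) with hmdef
  have hN' : (0 : ℝ) < N := Nat.cast_pos.2 hN
  let K : ℝ := N + ∑ i, |(b i : ℝ)|
  have hKN : (N : ℝ) ≤ K := le_add_of_nonneg_right (Finset.sum_nonneg fun i _ => abs_nonneg _)
  have hKb : ∀ i, |(b i : ℝ)| ≤ K := fun i =>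
    (Finset.single_le_sum (f := fun i => |(b i : ℝ)|) (fun i _ => abs_nonneg _)
      (Finset.mem_univ i)).trans (le_add_of_nonneg_left hN'.le)
  -- The multiplier will be `N * q` with `q ≤ Q = t / (2 * N)`, hence at most `t / 2`. Clearing
  -- denominators costs a factor `K` in the error, and rounding `Q ^ (1 / m)` down to `M` costs the
  -- `2`.
  refine ⟨2 * K * (2 * N) ^ (1 / m), 2 * N, fun t ht x s hx => ?_⟩
  have ht0 : 0 < t := lt_of_lt_of_le (by positivity) ht
  let Q : ℝ := t / (2 * N)
  have hQ : 1 ≤ Q := (one_le_div (by positivity)).2 ht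
  let M : ℕ := ⌊Q ^ (1 / m)⌋₊
  have hQ1 : 1 ≤ Q ^ (1 / m) := Real.one_le_rpow hQ (by positivity)
  have hM : 0 < M := Nat.floor_pos.2 hQ1
  have hM' : (1 : ℝ) ≤ M := by exact_mod_cast hM
  have hMle : (M : ℝ) ≤ Q ^ (1 / m) := Nat.floor_le (by positivity)
  have hMge : Q ^ (1 / m) ≤ 2 * M := by
    have := Nat.lt_floor_add_one (Q ^ (1 / m))
    have : Q ^ (1 / m) < M + 1 := this
    linarith
  have hMpow : (M : ℝ) ^ Fintype.card ι ≤ Q := by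
    calc (M : ℝ) ^ Fintype.card ι ≤ (Q ^ (1 / m)) ^ Fintype.card ι := by gcongr
      _ = Q := by
        rw [← Real.rpow_natCast, ← Real.rpow_mul (by positivity), ← hmdef,
          one_div_mul_cancel hm.ne', Real.rpow_one]
  obtain ⟨q, hq, hqM, p, hp⟩ :=
    exists_int_abs_mul_sub_le (fun o : ι => o.elim s (fun j => x j)) hM
  have hbound : K * (1 / M) ≤ 2 * K * (2 * N) ^ (1 / m) * t ^ (-(1 / m)) := by
    have h1 : (2 * (N : ℝ)) ^ (1 / m) * t ^ (-(1 / m)) = (Q ^ (1 / m))⁻¹ := by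
      rw [Real.div_rpow ht0.le (by positivity), Real.rpow_neg ht0.le, inv_div,
        div_eq_mul_inv ((2 * (N : ℝ)) ^ (1 / m))]
    rw [mul_assoc, h1, mul_comm 2 K, mul_assoc]
    refine mul_le_mul_of_nonneg_left ?_ (hN'.le.trans hKN)
    rw [← div_eq_mul_inv, div_le_div_iff₀ (by positivity) (by positivity)]
    linarith
  have hcoord : ∀ j, ∃ p' : ℤ, |((N * q : ℕ) : ℤ) * x j - p'| ≤ K * (1 / M) := by
    intro j
    by_cases h : j ∈ range σ
    · obtain ⟨i, rfl⟩ := h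
      -- Here `N * q * x (σ i) = q * a i + (q * s) * b i`, so only `q * s` needs rounding.
      refine ⟨q * a i + p none * b i, ?_⟩
      have : ((N * q : ℕ) : ℤ) * x (σ i) - ((q * a i + p none * b i : ℤ) : ℝ) =
          b i * (q * s - p none) := by
        rw [hx]
        push_cast
        rw [← ha, ← hb]
        ring
      rw [this, abs_mul]
      exact mul_le_mul (hKb _) (hp none) (abs_nonneg _) (hN'.le.trans hKN)
    · refine ⟨N * p (some ⟨j, h⟩), ?_⟩
      have : ((N * q : ℕ) : ℤ) * x j - ((N * p (some ⟨j, h⟩) : ℤ) : ℝ) =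
          N * (q * x j - p (some ⟨j, h⟩)) := by
        push_cast
        ring
      rw [this, abs_mul, abs_of_pos hN']
      exact mul_le_mul hKN (hp (some ⟨j, h⟩)) (abs_nonneg _) (hN'.le.trans hKN)
  choose p' hp' using hcoord
  refine ⟨(N * q : ℕ), p', by positivity, ?_, fun j => (hp' j).trans hbound⟩
  have hqQ : (q : ℝ) ≤ Q := le_trans (by exact_mod_cast hqM) hMpow
  rw [Int.cast_natCast, abs_of_nonneg (by positivity)]
  push_cast
  calc (N : ℝ) * q ≤ N * Q := by gcongr
    _ = t / 2 := by simp only [Q]; field_simp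

/-- The same, at half the rate `f`, where `f` is eventually larger than any multiple of the
Dirichlet rate. -/
theorem exists_forall_hasIntMultipleNear_half {n d : ℕ} {σ : Fin d → Fin n}
    (hσ : Function.Injective σ) {f : ℝ → ℝ}
    (hlim : Tendsto (fun t : ℝ => t ^ (1 / ((n : ℝ) - (d : ℝ) + 1)) * f t) atTop atTop)
    (c e : Fin d → ℚ) :
    ∃ T : ℝ, ∀ t, T ≤ t → ∀ (x : Fin n → ℝ) (s : ℝ), (∀ i, x (σ i) = c i + s * e i) →
      HasIntMultipleNear (f t / 2) (t / 2) x := by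
  obtain ⟨C, T, h⟩ := exists_hasIntMultipleNear_of_rational_line hσ c e
  obtain ⟨T', hT'⟩ := eventually_atTop.1
    ((hlim.eventually_ge_atTop (2 * C)).and (eventually_gt_atTop 0))
  refine ⟨max T T', fun t ht x s hx => ?_⟩
  obtain ⟨q, p, hq, hqt, hp⟩ := h t ((le_max_left _ _).trans ht) x s hx
  refine ⟨q, p, hq, hqt, fun i => (hp i).trans ?_⟩
  obtain ⟨h1, h2⟩ := hT' t ((le_max_right _ _).trans ht)
  have hpos := Real.rpow_pos_of_pos h2 (1 / ((n : ℝ) - (d : ℝ) + 1))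
  rw [Real.rpow_neg h2.le, ← div_eq_mul_inv, div_le_iff₀ hpos]
  linarith

/-- The halved bounds leave strict room, so a pair `(q, p)` valid at `(x, t)` stays valid nearby in
both variables; compactness of the time interval finishes. -/
theorem eventually_forall_hasIntMultipleNear {n : ℕ} {f : ℝ → ℝ} (hf : ∀ t, 0 < t → 0 < f t)
    (hfc : ContinuousOn f (Ioi 0)) {T T' : ℝ} (hT : 0 < T) {x : Fin n → ℝ}
    (hx : ∀ t ∈ Icc T T', HasIntMultipleNear (f t / 2) (t / 2) x) :
    ∀ᶠ x' in 𝓝 x, ∀ t ∈ Icc T T', HasIntMultipleNear (f t) t x' := by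
  refine isCompact_Icc.eventually_forall_of_forall_eventually fun t ht => ?_
  have ht0 : 0 < t := hT.trans_le ht.1
  obtain ⟨q, p, hq, hqt, hp⟩ := hx t ht
  have hft : ContinuousAt f t := hfc.continuousAt (Ioi_mem_nhds ht0)
  have h1 : ∀ᶠ z : (Fin n → ℝ) × ℝ in 𝓝 (x, t), |(q : ℝ)| < z.2 :=
    continuousAt_snd.eventually (lt_mem_nhds (by simp only; linarith))
  have h2 : ∀ i, ∀ᶠ z : (Fin n → ℝ) × ℝ in 𝓝 (x, t), |q * z.1 i - p i| < f z.2 := by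
    intro i
    have hl : ContinuousAt (fun z : (Fin n → ℝ) × ℝ => |q * z.1 i - p i|) (x, t) := by fun_prop
    have hr : ContinuousAt (fun z : (Fin n → ℝ) × ℝ => f z.2) (x, t) :=
      ContinuousAt.comp (f := Prod.snd) hft continuousAt_snd
    exact hl.eventually_lt hr ((hp i).trans_lt (half_lt_self (hf t ht0)))
  filter_upwards [h1, eventually_all.2 h2] with z hz1 hz2
  exact ⟨q, p, hq, hz1.le, fun i => (hz2 i).le⟩

/-! ### Nested balls -/

/-- A rational vector, as a real vector. -/
def ratVec {d : ℕ} (c : Fin d → ℚ) : Fin d → ℝ := fun i => c i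

theorem denseRange_ratVec {d : ℕ} : DenseRange (ratVec (d := d)) :=
  DenseRange.piMap fun _ => Rat.denseRange_cast

/-- Data for the nested balls construction: a closed ball with rational centre `c`, all of whose
points are approximable up to time `T`, while `c` is approximable with room to spare from time `T`
on. -/
structure IsApproximationBall {n d : ℕ} (f : ℝ → ℝ) (Ψ : (Fin d → ℝ) → (Fin n → ℝ))
    (B : Set (Fin d → ℝ)) (T₀ : ℝ) (c : Fin d → ℚ) (ρ T : ℝ) : Prop where
  radius_pos : 0 < ρ
  subset : Metric.closedBall (ratVec c) ρ ⊆ B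
  le : T₀ ≤ T
  near : ∀ u ∈ Metric.closedBall (ratVec c) ρ, ∀ t ∈ Ico T₀ T, HasIntMultipleNear (f t) t (Ψ u)
  center_near : ∀ t, T ≤ t → HasIntMultipleNear (f t / 2) (t / 2) (Ψ (ratVec c))

theorem IsApproximationBall.exists_next {n d : ℕ} {σ : Fin d → Fin n}
    (hσ : Function.Injective σ) {f : ℝ → ℝ} (hf : ∀ t, 0 < t → 0 < f t)
    (hfc : ContinuousOn f (Ioi 0))
    (hlim : Tendsto (fun t : ℝ => t ^ (1 / ((n : ℝ) - (d : ℝ) + 1)) * f t) atTop atTop)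
    {Ψ : (Fin d → ℝ) → (Fin n → ℝ)} {B : Set (Fin d → ℝ)}
    (hΨ : ∀ u ∈ B, ContinuousAt Ψ u) (hΨσ : ∀ u ∈ B, Ψ u ∘ σ = u) {R : Set (Fin d → ℝ)}
    (hcl : ∀ u ∈ B, u ∈ closure R → u ∈ R)
    (hline : ∀ c : Fin d → ℚ, ratVec c ∈ B →
      ∃ e : Fin d → ℚ, ∃ᶠ s : ℝ in 𝓝 0, ratVec c + s • ratVec e ∉ R)
    {T₀ : ℝ} (hT₀ : 0 < T₀) {c : Fin d → ℚ} {ρ T : ℝ} (h : IsApproximationBall f Ψ B T₀ c ρ T) :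
    ∃ (c' : Fin d → ℚ) (ρ' T' : ℝ), IsApproximationBall f Ψ B T₀ c' ρ' T' ∧
      Metric.closedBall (ratVec c') ρ' ⊆ Metric.closedBall (ratVec c) ρ ∧
      Disjoint (Metric.closedBall (ratVec c') ρ') R ∧ T + 1 ≤ T' := by
  have hcB : ratVec c ∈ B := h.subset (Metric.mem_closedBall_self h.radius_pos.le)
  obtain ⟨e, he⟩ := hline c hcB
  obtain ⟨T₁, hT₁⟩ := exists_forall_hasIntMultipleNear_half hσ hlim c e
  -- The old centre covers times up to `T'`; from `T₁` on, every point of the line is approximable.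
  -- The `+ 1` forces the times to infinity.
  let T' := max (T + 1) T₁
  have hev : ∀ᶠ u in 𝓝 (ratVec c), ∀ t ∈ Icc T T', HasIntMultipleNear (f t) t (Ψ u) :=
    (hΨ _ hcB).eventually (eventually_forall_hasIntMultipleNear hf hfc (hT₀.trans_le h.le)
      fun t ht => h.center_near t ht.1)
  obtain ⟨r, hr, hball⟩ := Metric.eventually_nhds_iff_ball.1
    (hev.and (Metric.ball_mem_nhds (ratVec c) h.radius_pos))
  let γ : ℝ → (Fin d → ℝ) := fun s => ratVec c + s • ratVec e
  have hγ : Continuous γ := by fun_prop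
  have hγ0 : γ 0 = ratVec c := by simp [γ]
  let O : Set (Fin d → ℝ) := Metric.ball (ratVec c) r ∩ (closure R)ᶜ
  have hO : IsOpen O := Metric.isOpen_ball.inter isClosed_closure.isOpen_compl
  have hOne : (γ ⁻¹' O).Nonempty := by
    have : ∀ᶠ s in 𝓝 0, γ s ∈ Metric.ball (ratVec c) r :=
      hγ.continuousAt.eventually (by rw [hγ0]; exact Metric.ball_mem_nhds _ hr)
    obtain ⟨s, hs, hs'⟩ := (he.and_eventually this).exists
    exact ⟨s, hs', fun hcls => hs (hcl _ (h.subset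
      (Metric.ball_subset_closedBall (hball _ hs').2)) hcls)⟩
  -- A rational parameter keeps the new centre rational, so that the step can be repeated.
  obtain ⟨s, hs⟩ := Rat.denseRange_cast.exists_mem_open (hO.preimage hγ) hOne
  let c' : Fin d → ℚ := c + s • e
  have hc' : ratVec c' = γ s := by
    ext i
    simp [ratVec, c', γ]
  have hc'O : ratVec c' ∈ O := hc' ▸ hs
  obtain ⟨ρ', hρ', hsub⟩ := Metric.nhds_basis_closedBall.mem_iff.1 (hO.mem_nhds hc'O)
  have hsub' : Metric.closedBall (ratVec c') ρ' ⊆ Metric.closedBall (ratVec c) ρ := fun u hu =>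
    Metric.ball_subset_closedBall (hball u (hsub hu).1).2
  refine ⟨c', ρ', T', ⟨hρ', hsub'.trans h.subset, h.le.trans ?_, fun u hu t ht => ?_,
    fun t ht => ?_⟩, hsub', ?_, le_max_left _ _⟩
  · exact (le_add_of_nonneg_right zero_le_one).trans (le_max_left _ _)
  · rcases lt_or_ge t T with htT | htT
    · exact h.near u (hsub' hu) t ⟨ht.1, htT⟩
    · exact (hball u (hsub hu).1).1 t ⟨htT, ht.2.le⟩
  · refine hT₁ t ((le_max_right _ _).trans ht) _ s fun i => ?_
    have hB : ratVec c' ∈ B := h.subset (hsub' (Metric.mem_closedBall_self hρ'.le))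
    have := congrFun (hΨσ _ hB) i
    rw [Function.comp_apply] at this
    rw [this, hc']
    simp [γ, ratVec]
  · exact disjoint_left.2 fun u hu huR => (hsub hu).2 (subset_closure huR)

/-- A graph over an open subset of `ℝᵈ` contains a uniformly approximable point outside countably
many relatively closed sets that do not contain germs of all rational lines. -/
theorem exists_hasIntMultipleNear_forall_notMem {n d : ℕ} {σ : Fin d → Fin n}
    (hσ : Function.Injective σ) {f : ℝ → ℝ} (hf : ∀ t, 0 < t → 0 < f t)
    (hfc : ContinuousOn f (Ioi 0))
    (hlim : Tendsto (fun t : ℝ => t ^ (1 / ((n : ℝ) - (d : ℝ) + 1)) * f t) atTop atTop)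
    {Ψ : (Fin d → ℝ) → (Fin n → ℝ)} {B : Set (Fin d → ℝ)} (hB : IsOpen B) (hBne : B.Nonempty)
    (hΨ : ∀ u ∈ B, ContinuousAt Ψ u) (hΨσ : ∀ u ∈ B, Ψ u ∘ σ = u) (R : ℕ → Set (Fin d → ℝ))
    (hcl : ∀ k, ∀ u ∈ B, u ∈ closure (R k) → u ∈ R k)
    (hline : ∀ k, ∀ c : Fin d → ℚ, ratVec c ∈ B →
      ∃ e : Fin d → ℚ, ∃ᶠ s : ℝ in 𝓝 0, ratVec c + s • ratVec e ∉ R k) :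
    ∃ u ∈ B, (∀ k, u ∉ R k) ∧ ∀ᶠ t in atTop, HasIntMultipleNear (f t) t (Ψ u) := by
  obtain ⟨c₀, hc₀⟩ := denseRange_ratVec.exists_mem_open hB hBne
  obtain ⟨ρ₀, hρ₀, hsub₀⟩ := Metric.nhds_basis_closedBall.mem_iff.1 (hB.mem_nhds hc₀)
  -- The degenerate line with direction `0` handles the single point `c₀`.
  obtain ⟨T₁, hT₁⟩ := exists_forall_hasIntMultipleNear_half hσ hlim c₀ 0
  let T₀ := max T₁ 1
  have hT₀ : 0 < T₀ := zero_lt_one.trans_le (le_max_right _ _)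
  have h₀ : IsApproximationBall f Ψ B T₀ c₀ ρ₀ T₀ := by
    refine ⟨hρ₀, hsub₀, le_rfl, fun u _ t ht => absurd ht.2 ht.1.not_gt, fun t ht => ?_⟩
    refine hT₁ t ((le_max_left _ _).trans ht) _ 0 fun i => ?_
    have := congrFun (hΨσ _ hc₀) i
    rw [Function.comp_apply] at this
    rw [this]
    simp [ratVec]
  let S := {s : (Fin d → ℚ) × ℝ × ℝ // IsApproximationBall f Ψ B T₀ s.1 s.2.1 s.2.2}
  let ball : S → Set (Fin d → ℝ) := fun s => Metric.closedBall (ratVec s.1.1) s.1.2.1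
  have hstep : ∀ (k : ℕ) (s : S), ∃ s' : S, ball s' ⊆ ball s ∧ Disjoint (ball s') (R k) ∧
      s.1.2.2 + 1 ≤ s'.1.2.2 := by
    intro k s
    obtain ⟨c', ρ', T', h', h⟩ :=
      s.2.exists_next hσ hf hfc hlim hΨ hΨσ (hcl k) (hline k) hT₀
    exact ⟨⟨(c', ρ', T'), h'⟩, h⟩
  choose next hnext using hstep
  let a : ℕ → S := fun k => Nat.rec ⟨(c₀, ρ₀, T₀), h₀⟩ (fun k s => next k s) k
  have ha : ∀ k, a (k + 1) = next k (a k) := fun k => rfl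
  obtain ⟨u, hu⟩ := IsCompact.nonempty_iInter_of_sequence_nonempty_isCompact_isClosed
    (fun k => ball (a k)) (fun k => ha k ▸ (hnext k (a k)).1)
    (fun k => ⟨_, Metric.mem_closedBall_self (a k).2.radius_pos.le⟩)
    (isCompact_closedBall _ _) (fun k => Metric.isClosed_closedBall)
  rw [mem_iInter] at hu
  refine ⟨u, (a 0).2.subset (hu 0), fun k huk => ?_, ?_⟩
  · have := hu (k + 1)
    rw [ha] at this
    exact disjoint_left.1 (hnext k (a k)).2.1 this huk
  · have hT : ∀ k : ℕ, (k : ℝ) ≤ (a k).1.2.2 := by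
      intro k
      induction k with
      | zero => exact_mod_cast hT₀.le
      | succ k ih =>
        have := (hnext k (a k)).2.2
        rw [ha]
        push_cast
        linarith
    filter_upwards [eventually_ge_atTop T₀] with t ht
    obtain ⟨k, hk⟩ := exists_nat_gt t
    exact (a k).2.near u (hu k) t ⟨ht, hk.trans_le (hT k)⟩

/-- A locally analytic, relatively closed, proper subset of a ball does not contain the germs at a
rational point of all rational lines. -/
theorem exists_frequently_rational_line_notMem {d : ℕ} {b : Fin d → ℝ} {r : ℝ}
    {R : Set (Fin d → ℝ)}
    (hcl : ∀ u ∈ Metric.ball b r, u ∈ closure R → u ∈ R)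
    (hR : ∀ u ∈ Metric.ball b r, u ∈ R → ∃ g : (Fin d → ℝ) → ℝ, AnalyticAt ℝ g u ∧
      ∀ᶠ x in 𝓝 u, (x ∈ R ↔ g x = 0))
    (hne : ¬ Metric.ball b r ⊆ R) {c : Fin d → ℚ} (hc : ratVec c ∈ Metric.ball b r) :
    ∃ e : Fin d → ℚ, ∃ᶠ s : ℝ in 𝓝 0, ratVec c + s • ratVec e ∉ R := by
  by_contra! hcon
  -- The line from `c` to a rational `v` has rational direction; its germ at `c` lies in `R`, and
  -- analytic continuation along the segment reaches `v`.
  have hrat : ∀ v : Fin d → ℚ, ratVec v ∈ Metric.ball b r → ratVec v ∈ R := by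
    intro v hv
    let γ : ℝ → (Fin d → ℝ) := fun s => ratVec c + s • ratVec (v - c)
    have hγ : Continuous γ := by fun_prop
    have hγ' : ∀ s, AnalyticAt ℝ γ s := fun s =>
      analyticAt_const.add (analyticAt_id.smul analyticAt_const)
    have hγ0 : γ 0 = ratVec c := by simp [γ]
    have hγ1 : γ 1 = ratVec v := by
      ext i
      simp [γ, ratVec]
    have hline : γ = AffineMap.lineMap (ratVec c) (ratVec v) := by
      ext s i
      simp [γ, ratVec, AffineMap.lineMap_apply]
      ring
    let J : Set ℝ := γ ⁻¹' Metric.ball b r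
    have hJ : IsPreconnected J := by
      have : Convex ℝ J := by
        change Convex ℝ (γ ⁻¹' Metric.ball b r)
        rw [hline]
        exact (convex_ball b r).affine_preimage _
      exact this.isPreconnected
    have hsub : J ⊆ γ ⁻¹' R := by
      refine subset_of_eventually_mem_of_locally_analytic hJ ?_ ?_
        (s₀ := 0) (by simpa [J, hγ0] using hc) (hcon (v - c))
      · intro s hs hscl
        exact hcl _ hs (closure_mono (image_preimage_subset γ R)
          (mem_closure_image hγ.continuousAt hscl))
      · intro s hs hsR
        obtain ⟨g, hg, hgR⟩ := hR _ hs hsR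
        exact ⟨g ∘ γ, hg.comp (hγ' s), hγ.continuousAt.eventually hgR⟩
    have h1 : (1 : ℝ) ∈ J := by simpa [J, hγ1] using hv
    have := hsub h1
    rwa [mem_preimage, hγ1] at this
  apply hne
  intro u hu
  refine hcl u hu (mem_closure_iff.2 fun O hO huO => ?_)
  obtain ⟨v, hvO, hvb⟩ := denseRange_ratVec.exists_mem_open (hO.inter Metric.isOpen_ball)
    ⟨u, huO, hu⟩
  exact ⟨_, hvO, hrat v hvb⟩

theorem subset_closure_UA_diff_of_isProperAnalyticSubset {n d : ℕ} {Y : Set (Fin n → ℝ)}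
    (hY : IsAnalyticSubmanifold d Y) (hYconn : IsConnected Y) {f : ℝ → ℝ}
    (hf : ∀ t, 0 < t → 0 < f t) (hfc : ContinuousOn f (Ioi 0))
    (hlim : Tendsto (fun t : ℝ => t ^ (1 / ((n : ℝ) - (d : ℝ) + 1)) * f t) atTop atTop)
    {𝓡 : Set (Set (Fin n → ℝ))} (hc : 𝓡.Countable)
    (h𝓡 : ∀ R ∈ 𝓡, IsProperAnalyticSubset R Y) :
    Y ⊆ closure ({x | x ∈ Y ∧ toColumn x ∈ UA n 1 f} \ ⋃₀ 𝓡) := by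
  intro y hy
  refine mem_closure_iff.2 fun O hO hyO => ?_
  -- Inserting `∅` makes the family nonempty, so that a sequence enumerates it.
  obtain ⟨F, hF⟩ := (hc.insert ∅).exists_eq_range (insert_nonempty ∅ 𝓡)
  have hFR : ∀ k, IsProperAnalyticSubset (F k) Y := by
    intro k
    rcases (hF ▸ mem_range_self k : F k ∈ insert ∅ 𝓡) with h | h
    · rw [h]
      exact ⟨⟨y, hy, notMem_empty y⟩, fun _ _ h => by simp at h, fun _ _ h => h.elim⟩
    · exact h𝓡 _ h
  obtain ⟨σ, Ψ, hσ, hΨ, hΨy, hmem, hgraph⟩ := hY.exists_graph hy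
  have hΨO : ∀ᶠ u in 𝓝 (y ∘ σ), Ψ u ∈ O :=
    hΨ.continuousAt.eventually (by rw [hΨy]; exact hO.mem_nhds hyO)
  obtain ⟨r, hr, hball⟩ := Metric.eventually_nhds_iff_ball.1
    (hΨ.eventually_analyticAt.and (hmem.and hΨO))
  let R : ℕ → Set (Fin d → ℝ) := fun k => {u | u ∈ Metric.ball (y ∘ σ) r ∧ Ψ u ∈ F k}
  have hcl : ∀ k, ∀ u ∈ Metric.ball (y ∘ σ) r, u ∈ closure (R k) → u ∈ R k := by
    intro k u hu hucl
    refine ⟨hu, (hFR k).mem_of_mem_closure _ (hball u hu).2.1.1 ?_⟩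
    exact closure_mono (by rintro _ ⟨v, hv, rfl⟩; exact hv.2)
      (mem_closure_image (hball u hu).1.continuousAt hucl)
  have hanal : ∀ k, ∀ u ∈ Metric.ball (y ∘ σ) r, u ∈ R k → ∃ g : (Fin d → ℝ) → ℝ,
      AnalyticAt ℝ g u ∧ ∀ᶠ x in 𝓝 u, (x ∈ R k ↔ g x = 0) := by
    intro k u hu huR
    obtain ⟨g, hg, hgR⟩ := (hFR k).exists_analyticAt _ (hball u hu).2.1.1 huR.2
    refine ⟨g ∘ Ψ, hg.comp (hball u hu).1, ?_⟩
    filter_upwards [(hball u hu).1.continuousAt.eventually hgR,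
      Metric.isOpen_ball.mem_nhds hu] with x hx hxb
    rw [Function.comp_apply, ← hx (hball x hxb).2.1.1]
    exact ⟨fun h => h.2, fun h => ⟨hxb, h⟩⟩
  have hne : ∀ k, ¬ Metric.ball (y ∘ σ) r ⊆ R k := by
    intro k hsub
    refine (hFR k).not_eventually_mem hY hYconn.isPreconnected hy ?_
    have hπ : Continuous fun z : Fin n → ℝ => z ∘ σ :=
      continuous_pi fun i => continuous_apply (σ i)
    filter_upwards [hgraph, hπ.continuousAt.eventually (Metric.ball_mem_nhds (y ∘ σ) hr)]
      with z hz hzb hzY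
    exact hz hzY ▸ (hsub hzb).2
  obtain ⟨u, hu, huR, hnear⟩ := exists_hasIntMultipleNear_forall_notMem hσ hf hfc hlim
    Metric.isOpen_ball ⟨_, Metric.mem_ball_self hr⟩ (fun u hu => (hball u hu).1.continuousAt)
    (fun u hu => (hball u hu).2.1.2) R hcl
    (fun k c hcb => exists_frequently_rational_line_notMem (hcl k) (hanal k) (hne k) hcb)
  refine ⟨Ψ u, (hball u hu).2.2, ⟨(hball u hu).2.1.1, toColumn_mem_UA hf hnear⟩, ?_⟩
  rintro ⟨S, hS, huS⟩
  obtain ⟨k, rfl⟩ : S ∈ range F := hF ▸ mem_insert_of_mem _ hS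
  exact huR k ⟨hu, huS⟩

/-! ### Uncountability, total irrationality and the exponent -/

theorem IsAnalyticSubmanifold.nontrivial {n d : ℕ} (hd : 0 < d) {Y : Set (Fin n → ℝ)}
    (hY : IsAnalyticSubmanifold d Y) (hne : Y.Nonempty) : Y.Nontrivial := by
  obtain ⟨y, hy⟩ := hne
  obtain ⟨σ, Ψ, -, -, -, hmem, -⟩ := hY.exists_graph hy
  have : Nonempty (Fin d) := ⟨⟨0, hd⟩⟩
  have : (𝓝[≠] (y ∘ σ)).NeBot := Module.punctured_nhds_neBot ℝ _ _
  obtain ⟨u, hu, hne⟩ := ((hmem.filter_mono (nhdsWithin_le_nhds (s := {y ∘ σ}ᶜ))).and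
    self_mem_nhdsWithin).exists
  refine ⟨y, hy, Ψ u, hu.1, fun h => hne ?_⟩
  rw [mem_singleton_iff, h, hu.2]

theorem isUncountableDenseIn_UA_diff {n d : ℕ} (hd : 0 < d) {Y : Set (Fin n → ℝ)}
    (hY : IsAnalyticSubmanifold d Y) (hYconn : IsConnected Y) {f : ℝ → ℝ}
    (hf : ∀ t, 0 < t → 0 < f t) (hfc : ContinuousOn f (Ioi 0))
    (hlim : Tendsto (fun t : ℝ => t ^ (1 / ((n : ℝ) - (d : ℝ) + 1)) * f t) atTop atTop)
    {𝓡 : Set (Set (Fin n → ℝ))} (hc : 𝓡.Countable)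
    (h𝓡 : ∀ R ∈ 𝓡, IsProperAnalyticSubset R Y) :
    IsUncountableDenseIn ({x | x ∈ Y ∧ toColumn x ∈ UA n 1 f} \ ⋃₀ 𝓡) Y := by
  refine ⟨fun x hx => hx.1.1, fun hS => ?_,
    subset_closure_UA_diff_of_isProperAnalyticSubset hY hYconn hf hfc hlim hc h𝓡⟩
  set S := {x | x ∈ Y ∧ toColumn x ∈ UA n 1 f} \ ⋃₀ 𝓡
  -- If the set were countable, its points could be forbidden as singletons as well, and density
  -- would still produce another point.
  have hsub := subset_closure_UA_diff_of_isProperAnalyticSubset hY hYconn hf hfc hlim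
    (hc.union (hS.image fun x => {x})) (by
      rintro R (hR | ⟨x, -, rfl⟩)
      · exact h𝓡 R hR
      · exact isProperAnalyticSubset_singleton (hY.nontrivial hd hYconn.nonempty) x)
  obtain ⟨y, hy⟩ := hYconn.nonempty
  obtain ⟨x, hx, hx'⟩ := closure_nonempty_iff.1 ⟨y, hsub hy⟩
  rw [sUnion_union] at hx'
  have hxS : x ∈ S := ⟨hx, fun h => hx' (Or.inl h)⟩
  exact hx' (Or.inr ⟨{x}, ⟨x, hxS, rfl⟩, rfl⟩)

theorem IsUncountableDenseIn.mono {n : ℕ} {S S' Y : Set (Fin n → ℝ)}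
    (h : IsUncountableDenseIn S Y) (hSS' : S ⊆ S') (hS'Y : S' ⊆ Y) :
    IsUncountableDenseIn S' Y :=
  ⟨hS'Y, fun hc => h.2.1 (hc.mono hSS'), h.2.2.trans (closure_mono hSS')⟩

/-- The affine subspace with underlying set `rationalHyperplane e`. -/
def rationalHyperplaneSubspace {n : ℕ} (e : (Fin n → ℚ) × ℚ) :
    AffineSubspace ℝ (Fin n → ℝ) where
  carrier := rationalHyperplane e
  smul_vsub_vadd_mem' := by
    intro c p₁ p₂ p₃ h₁ h₂ h₃
    simp only [rationalHyperplane, mem_ofPred_eq] at h₁ h₂ h₃ ⊢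
    have : ∑ i, (e.1 i : ℝ) * (c • (p₁ -ᵥ p₂) +ᵥ p₃) i =
        c * (∑ i, (e.1 i : ℝ) * p₁ i - ∑ i, (e.1 i : ℝ) * p₂ i) + ∑ i, (e.1 i : ℝ) * p₃ i := by
      rw [← Finset.sum_sub_distrib, Finset.mul_sum, ← Finset.sum_add_distrib]
      refine Finset.sum_congr rfl fun i _ => ?_
      simp only [vsub_eq_sub, vadd_eq_add, Pi.add_apply, Pi.smul_apply, Pi.sub_apply, smul_eq_mul]
      ring
    rw [this, h₁, h₂, h₃, sub_self, mul_zero, zero_add]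

/-- A vector is totally irrational once it avoids all rational hyperplanes not containing `Y`. -/
theorem isTotallyIrrational_of_notMem_rationalHyperplane {n : ℕ} {Y : Set (Fin n → ℝ)}
    (hY : ∀ S : AffineSubspace ℝ (Fin n → ℝ), IsRationalAffineSubspace S → S ≠ ⊤ →
      ¬ Y ⊆ (S : Set (Fin n → ℝ))) {x : Fin n → ℝ}
    (hx : ∀ e : (Fin n → ℚ) × ℚ, ¬ Y ⊆ rationalHyperplane e → x ∉ rationalHyperplane e) :
    IsTotallyIrrational x := by
  rintro S ⟨-, E, hE⟩ hS hxS
  have hxE : ∀ e ∈ E, x ∈ rationalHyperplane e := by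
    have : x ∈ (S : Set (Fin n → ℝ)) := hxS
    rw [hE] at this
    exact this
  -- As `S` is proper, one of its equations is not satisfied everywhere; that hyperplane is proper
  -- and cannot contain `Y`.
  obtain ⟨e, he, z, hz⟩ : ∃ e ∈ E, ∃ z, z ∉ rationalHyperplane e := by
    by_contra! hcon
    apply hS
    rw [← AffineSubspace.coe_eq_univ_iff, hE, eq_univ_iff_forall]
    exact fun z e he => hcon e he z
  refine hx e (hY (rationalHyperplaneSubspace e) ⟨⟨x, hxE e he⟩, {e}, ?_⟩ fun htop => hz ?_)
    (hxE e he)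
  · ext w
    simp only [mem_ofPred_eq, mem_singleton_iff, forall_eq]
    rfl
  · have : z ∈ rationalHyperplaneSubspace e := htop ▸ AffineSubspace.mem_top ℝ _ z
    exact this

theorem isUncountableDenseIn_UA_inter_isTotallyIrrational {n d : ℕ} (hd : 0 < d)
    {Y : Set (Fin n → ℝ)} (hY : IsAnalyticSubmanifold d Y) (hYconn : IsConnected Y) {f : ℝ → ℝ}
    (hf : ∀ t, 0 < t → 0 < f t) (hfc : ContinuousOn f (Ioi 0))
    (hlim : Tendsto (fun t : ℝ => t ^ (1 / ((n : ℝ) - (d : ℝ) + 1)) * f t) atTop atTop)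
    (hYr : ∀ S : AffineSubspace ℝ (Fin n → ℝ), IsRationalAffineSubspace S → S ≠ ⊤ →
      ¬ Y ⊆ (S : Set (Fin n → ℝ))) :
    IsUncountableDenseIn {x | x ∈ Y ∧ toColumn x ∈ UA n 1 f ∧ IsTotallyIrrational x} Y := by
  refine (isUncountableDenseIn_UA_diff hd hY hYconn hf hfc hlim
    (𝓡 := rationalHyperplane '' {e | ¬ Y ⊆ rationalHyperplane e})
    ((to_countable _).image _) ?_).mono ?_ fun x hx => hx.1
  · rintro _ ⟨e, he, rfl⟩
    exact isProperAnalyticSubset_rationalHyperplane e he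
  · rintro x ⟨⟨hxY, hxU⟩, hx⟩
    exact ⟨hxY, hxU, isTotallyIrrational_of_notMem_rationalHyperplane hYr fun e he hxe =>
      hx ⟨_, ⟨e, he, rfl⟩, hxe⟩⟩

/-- For each `a < α` the logarithmic factor is eventually below `t ^ (α - a)`, so every positive `a
< α` is admissible. -/
theorem le_uniformExponent_of_mem_UA_log {m n : ℕ} {α : ℝ} (hα : 0 < α)
    {A : Matrix (Fin m) (Fin n) ℝ}
    (hA : A ∈ UA m n fun t => t ^ (-α) * (1 + |Real.log t|)) :
    (α : EReal) ≤ uniformExponent A := by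
  refine le_of_forall_lt fun c hc => ?_
  -- The maximum with `0` ensures that the intermediate exponent is positive.
  obtain ⟨a, hca, haα⟩ := EReal.lt_iff_exists_real_btwn.1
    (max_lt hc (EReal.coe_pos.2 hα))
  have ha0 : 0 < a := EReal.coe_pos.1 ((le_max_right _ _).trans_lt hca)
  have haα' : a < α := EReal.coe_lt_coe_iff.1 haα
  refine ((le_max_left _ _).trans_lt hca).trans_le (le_sSup ⟨a, ⟨ha0, ?_⟩, rfl⟩)
  have hs : 0 < α - a := sub_pos.2 haα'
  have hlog := (isLittleO_log_rpow_atTop hs).bound (c := 1 / 2) (by norm_num)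
  have hA' : ∀ᶠ t : ℝ in atTop, _ := hA
  change ∀ᶠ t : ℝ in atTop, _
  filter_upwards [hA', hlog, (tendsto_rpow_atTop hs).eventually_ge_atTop 2,
    eventually_gt_atTop 0] with t ht hlt h2 ht0
  obtain ⟨q, p, hq, hqp, hqt⟩ := ht
  refine ⟨q, p, hq, hqp.trans ?_, hqt⟩
  rw [Real.norm_eq_abs, Real.norm_eq_abs, abs_of_pos (Real.rpow_pos_of_pos ht0 _)] at hlt
  calc t ^ (-α) * (1 + |Real.log t|) ≤ t ^ (-α) * t ^ (α - a) := by
        refine mul_le_mul_of_nonneg_left ?_ (Real.rpow_nonneg ht0.le _)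
        linarith
    _ = t ^ (-a) := by
        rw [← Real.rpow_add ht0]
        congr 1
        ring

theorem theorem6p2 (n d : ℕ) (hn : 2 ≤ n) (hd : 2 ≤ d) (Y : Set (Fin n → ℝ))
    (hY : IsAnalyticSubmanifold d Y) (hYconn : IsConnected Y) :
    (∀ f : ℝ → ℝ, (∀ t, 0 < t → 0 < f t) → ContinuousOn f (Ioi 0) →
      (∃ T : ℝ, 0 < T ∧
        MonotoneOn (fun t : ℝ => t ^ (1 / ((n : ℝ) - (d : ℝ) + 1)) * f t) (Ici T)) →
      Tendsto (fun t : ℝ => t ^ (1 / ((n : ℝ) - (d : ℝ) + 1)) * f t) atTop atTop →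
      (∀ 𝓡 : Set (Set (Fin n → ℝ)), 𝓡.Countable →
        (∀ R ∈ 𝓡, IsProperClosedAnalyticSubmanifold R Y) →
        IsUncountableDenseIn ({x | x ∈ Y ∧ toColumn x ∈ UA n 1 f} \ ⋃₀ 𝓡) Y) ∧
      ((∀ S : AffineSubspace ℝ (Fin n → ℝ), IsRationalAffineSubspace S → S ≠ ⊤ →
          ¬ Y ⊆ (S : Set (Fin n → ℝ))) →
        IsUncountableDenseIn {x | x ∈ Y ∧ toColumn x ∈ UA n 1 f ∧ IsTotallyIrrational x} Y)) ∧
    ((∀ S : AffineSubspace ℝ (Fin n → ℝ), IsRationalAffineSubspace S → S ≠ ⊤ →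
        ¬ Y ⊆ (S : Set (Fin n → ℝ))) →
      IsUncountableDenseIn {x | x ∈ Y ∧ IsTotallyIrrational x ∧
        ((1 / ((n : ℝ) - (d : ℝ) + 1) : ℝ) : EReal) ≤ uniformExponent (toColumn x)} Y) := by
  have hd0 : 0 < d := by omega
  refine ⟨fun f hf hfc _ hlim => ⟨fun 𝓡 hc h𝓡 => ?_, fun hYr => ?_⟩, fun hYr => ?_⟩
  · exact isUncountableDenseIn_UA_diff hd0 hY hYconn hf hfc hlim hc fun R hR =>
      (h𝓡 R hR).isProperAnalyticSubset
  · exact isUncountableDenseIn_UA_inter_isTotallyIrrational hd0 hY hYconn hf hfc hlim hYr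
  · obtain ⟨y, hy⟩ := hYconn.nonempty
    obtain ⟨σ, -, hσ, -⟩ := hY.exists_graph hy
    have hdn : (d : ℝ) ≤ n := by
      exact_mod_cast (by simpa using Fintype.card_le_of_injective σ hσ : d ≤ n)
    set α : ℝ := 1 / ((n : ℝ) - (d : ℝ) + 1) with hα
    have hα0 : 0 < α := one_div_pos.2 (by linarith)
    -- The factor `1 + |log t|` is positive for all `t > 0`, tends to infinity, and is too slow to
    -- affect the exponent.
    refine (isUncountableDenseIn_UA_inter_isTotallyIrrational hd0 hY hYconn
      (f := fun t => t ^ (-α) * (1 + |Real.log t|)) (fun t ht => by positivity) ?_ ?_ hYr).mono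
      (fun x hx => ⟨hx.1, hx.2.2, le_uniformExponent_of_mem_UA_log hα0 hx.2.1⟩) fun x hx => hx.1
    · intro t ht
      have ht' : t ≠ 0 := (mem_Ioi.1 ht).ne'
      exact ((Real.continuousAt_rpow_const t (-α) (Or.inl ht')).mul
        (continuousAt_const.add (Real.continuousAt_log ht').abs)).continuousWithinAt
    · rw [← hα]
      refine (tendsto_atTop_add_const_left _ 1
        (tendsto_abs_atTop_atTop.comp Real.tendsto_log_atTop)).congr' ?_
      filter_upwards [eventually_gt_atTop 0] with t ht
      rw [← mul_assoc, ← Real.rpow_add ht, add_neg_cancel, Real.rpow_zero, one_mul]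
      rfl
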